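/- Let $\Sigma$ be a finite alphabet. Languages are sets of nonempty words over $\Sigma$. \emph{Real-time cellular automata.} A two-way cellular automaton $\mathcal A$ over $\Sigma$ consists of a finite set of states $Q\supset\Sigma$, a border state $\sharp\in Q\setminus\Sigma$, a set $Q_{accept}\subseteq Q$ of accepting states and a transition function $\delta:Q^3\to Q$ (neighborhood $\{-1,0,1\}$). On an input word $w=w_1\dots w_n$, $n\ge 1$, the state $\langle c,t\rangle$ of cell $c\in\mathbb Z$ at time $t\ge 1$ is given by: $\langle c,t\rangle=\sharp$ for all $t$ if $c\notin[1,n]$; $\langle c,1\rangle=w_c$ if $c\in[1,n]$ (parallel input); and $\langle c,t\rangle=\delta(\langle c-1,t-1\rangle,\langle c,t-1\rangle,\langle c+1,t-1\rangle)$ if $c\in[1,n]$ and $t>1$. The word $w$ is accepted in real time if $\langle 1,n\rangle\in Q_{accept}$ (the output cell is the first cell). $\mathtt{RealTime_{CA}}$ is the class of languages over $\Sigma$ that are the set of all nonempty words accepted in real time by some such automaton. \emph{Predecessor Horn formulas.} A nonempty word $w=w_1\dots w_n$ is encoded by the structure $\langle w\rangle$ with domain $[1,n]=\{1,\dots,n\}$,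 unary predicates $Q_s$ ($s\in\Sigma$), $\mathtt{min}$, $\mathtt{max}$ with $Q_s(i)\iff w_i=s$, $\mathtt{min}(i)\iff i=1$, $\mathtt{max}(i)\iff i=n$, and the predecessor function $\mathtt{pred}(i)=i-1$ for $i>1$, $\mathtt{pred}(1)=1$. For an integer $a\ge0$, $x-a$ denotes the term $\mathtt{pred}^a(x)$. A predecessor Horn formula is a formula $\Phi=\exists\mathbf R\,\forall x\,\forall y\,\psi(x,y)$, where $\mathbf R$ is a finite set of binary predicates and $\psi$ is a finite conjunction of clauses $\delta_1\wedge\dots\wedge\delta_r\to\delta_0$ ($r\ge 0$) such that $\delta_0$ is either $R(x,y)$ with $R\in\mathbf R$ or $\bot$ (false), and each hypothesis $\delta_i$ ($1\le i\le r$) has one of the following forms, with integers $a,b\ge 0$: $Q_s(x-a)$ or $Q_s(y-a)$ for $s\in\Sigma$; $U(x-a)$, $\neg U(x-a)$, $U(y-a)$ or $\neg U(y-a)$ for $U\in\{\mathtt{min},\mathtt{max}\}$; $S(x-a,y-b)$ or $S(y-b,x-a)$ for $S\in\mathbf R$. The formula $\Phi$ defines the language of all nonempty words $w$ over $\Sigma$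 such that $\langle w\rangle\models\Phi$, and $\mathtt{pred}\text{-}\mathtt{ESO}\text{-}\mathtt{HORN}$ is the class of languages over $\Sigma$ defined by predecessor Horn formulas. \textbf{Theorem.} $\mathtt{RealTime_{CA}}=\mathtt{pred}\text{-}\mathtt{ESO}\text{-}\mathtt{HORN}$. -/

import Mathlib

/-! ## One-dimensional cellular automata -/

/-- A one-dimensional cellular automaton with input alphabet `α` and neighborhood `N`:
a finite set `Q` of states containing the input alphabet and the permanent border state `♯`,
a set of accepting states, and a transition function giving the next state of a cell `c`
from the current states of the cells `c + v`, `v ∈ N`. -/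
structure CellularAutomaton (α : Type*) (N : Finset ℤ) where
  Q : Type
  finite_Q : Finite Q
  letter : α ↪ Q
  sharp : Q
  sharp_ne_letter : ∀ s : α, sharp ≠ letter s
  accept : Set Q
  δ : ((v : ℤ) → v ∈ N → Q) → Q

namespace CellularAutomaton

variable {α : Type*} {N : Finset ℤ}

/-- The state of cell `c` at time `k + 1` (that is, after `k` steps) on the word `w = w₁ … wₙ` with
parallel input: cell `i ∈ [1,n]` holds `wᵢ` at time `1`, and all the cells outside `[1,n]` are
permanently in state `♯`. -/
def stateAfter (A : CellularAutomaton α N) (w : List α) : ℕ → ℤ → A.Q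
  | 0, c =>
    if h : 1 ≤ c ∧ c ≤ (w.length : ℤ) then
      A.letter (w.get ⟨(c - 1).toNat, by omega⟩)
    else A.sharp
  | k + 1, c =>
    if 1 ≤ c ∧ c ≤ (w.length : ℤ) then
      A.δ (fun v _ => A.stateAfter w k (c + v))
    else A.sharp

/-- The language accepted in real time with parallel input, output cell `1` and neighborhood
`{-1, 0, 1}`: the nonempty words `w` of length `n` such that cell `1` is in an accepting state
at time `n`, i.e. after `n - 1` steps (the first instant at which it has received every letter). -/
def realTimeLanguage (A : CellularAutomaton α {-1, 0, 1}) : Language α :=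
  {w | w ≠ [] ∧ A.stateAfter w (w.length - 1) 1 ∈ A.accept}

end CellularAutomaton

/-- The class `RealTime_CA` of languages over `α`. -/
def RealTimeCA (α : Type*) : Set (Language α) :=
  {L | ∃ A : CellularAutomaton α {-1, 0, 1}, A.realTimeLanguage = L}

/-! ## Predecessor Horn formulas -/

namespace PredHorn

/-- The two first-order variables. -/
inductive Var
  | x
  | y

/-- The input predicates `min` and `max`. -/
inductive Extremum
  | min
  | max

/-- The hypotheses allowed in a clause, over the alphabet `α` and the set `ρ` of (binary)
computation predicates. -/
inductive Hypothesis (α : Type*) (ρ : Type)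
  /-- `Q_s(v - a)` -/
  | letter (s : α) (v : Var) (a : ℕ)
  /-- `U(v - a)` -/
  | pos (U : Extremum) (v : Var) (a : ℕ)
  /-- `¬ U(v - a)` -/
  | neg (U : Extremum) (v : Var) (a : ℕ)
  /-- `S(x - a, y - b)` -/
  | compXY (S : ρ) (a b : ℕ)
  /-- `S(y - b, x - a)` -/
  | compYX (S : ρ) (b a : ℕ)

/-- A Horn clause `δ₁ ∧ … ∧ δᵣ → δ₀`; the conclusion `δ₀` is `R(x,y)` for `some R` and `⊥` for
`none`. -/
structure Clause (α : Type*) (ρ : Type) where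
  hyps : List (Hypothesis α ρ)
  concl : Option ρ

/-- A predecessor Horn formula `∃ 𝐑 ∀ x ∀ y ψ(x,y)`, where `𝐑` is a finite set of binary
predicates, and `ψ` is a (finite) conjunction of Horn clauses. -/
structure Formula (α : Type*) where
  ρ : Type
  finite_ρ : Finite ρ
  clauses : List (Clause α ρ)

variable {α : Type*} {ρ : Type}

/-! The word `w = w₁ … wₙ` is encoded by a structure with domain `[1,n]`. The domain is represented
by `Fin w.length`, where `i : Fin w.length` stands for the position `i + 1`. -/

/-- The function `pred` of the word structure: `pred(i) = i - 1` for `i > 1`, and `pred(1) = 1`. -/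
def pred {n : ℕ} (i : Fin n) : Fin n :=
  ⟨i.val - 1, by omega⟩

/-- The interpretation of `min` and `max` in the word structure. -/
def Extremum.Holds {n : ℕ} : Extremum → Fin n → Prop
  | .min, i => i.val + 1 = 1
  | .max, i => i.val + 1 = n

/-- The value of a variable when `x = i` and `y = j`. -/
def Var.value {n : ℕ} (i j : Fin n) : Var → Fin n
  | .x => i
  | .y => j

/-- Truth of a hypothesis in the structure of `w` expanded by the relations `R`, when `x = i` and
`y = j`; the term `v - a` denotes `predᵃ(v)`. -/
def Hypothesis.Holds (w : List α) (R : ρ → Fin w.length → Fin w.length → Prop)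
    (i j : Fin w.length) : Hypothesis α ρ → Prop
  | .letter s v a => w.get (pred^[a] (v.value i j)) = s
  | .pos U v a => U.Holds (pred^[a] (v.value i j))
  | .neg U v a => ¬ U.Holds (pred^[a] (v.value i j))
  | .compXY S a b => R S (pred^[a] i) (pred^[b] j)
  | .compYX S b a => R S (pred^[b] j) (pred^[a] i)

/-- Truth of a clause when `x = i` and `y = j`. -/
def Clause.Holds (C : Clause α ρ) (w : List α) (R : ρ → Fin w.length → Fin w.length → Prop)
    (i j : Fin w.length) : Prop :=
  (∀ h ∈ C.hyps, h.Holds w R i j) →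
    match C.concl with
    | some S => R S i j
    | none => False

/-- The structure of the word `w` satisfies `∃ 𝐑 ∀ x ∀ y ψ(x,y)`. -/
def Formula.Sat (Φ : Formula α) (w : List α) : Prop :=
  ∃ R : Φ.ρ → Fin w.length → Fin w.length → Prop,
    ∀ i j : Fin w.length, ∀ C ∈ Φ.clauses, C.Holds w R i j

/-- The language (of nonempty words) defined by a formula. -/
def Formula.language (Φ : Formula α) : Language α :=
  {w | w ≠ [] ∧ Φ.Sat w}

end PredHorn

/-- The class `pred-ESO-HORN` of languages over `α`. -/
def PredESOHorn (α : Type*) : Set (Language α) :=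
  {L | ∃ Φ : PredHorn.Formula α, Φ.language = L}

/-! From formulas to automata. The existential Horn formula holds iff the least model of its clauses
does not derive falsity (`Formula.sat_iff`). The square of pairs is folded onto the triangle x ≤ y
by treating the atoms at (x, y) and (y, x) together, and `signature` records a bounded window of
them, which has finitely many values. Derivations only look at bounded predecessors, so
(`Least.transfer`) the signature at a point is a function of those at its two predecessors; on the
edge where x is the first position one predecessor and the new letter suffice, and on the diagonal
symmetry replaces the missing predecessor. The obstacle is `max`: while the recurrence advances, the
end of the word is unknown. Each signature therefore keeps two least models, one with `max` nowhere,
which is what later values of y inherit, and one with `max` at y, which is the right one if y turns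
out to be last (`least_maxAt_succ`). Such a triangular recurrence runs in real time
(`mem_realTimeCA_of_triangle`): counting from 0, the point (k - c, k + c) is placed on cell c after
k steps, and two consecutive antidiagonals are packed into each step, so the corner (n - 1, n - 1)
reaches the output cell after n - 1 steps. From automata to formulas. With (x, y), x ≤ y, standing
for cell y - x + 1 at time x, the three neighbors one step earlier are (x - 1, y - 2), (x - 1, y -
1) and (x - 1, y), so a transition is a Horn clause. The triangle is exactly the dependence cone of
the output, which meets the border only on the left, along x = y. The true states form a model, and
every model contains them. -/

/-! ## Triangular recurrences are computed in real time -/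

namespace CellularAutomaton

variable {α : Type*}

/-- Every language accepted through a finite transition table on three neighbors, over a state type
living in any universe, is a real-time language. -/
theorem mem_realTimeCA_of_step {Q : Type*} [Finite Q] (letter : α ↪ Q) (sharp : Q)
    (hsharp : ∀ s, sharp ≠ letter s) (step : Q → Q → Q → Q) (acc : Set Q)
    (st : List α → ℕ → ℤ → Q) (hst0 : ∀ w c, ¬ (1 ≤ c ∧ c ≤ (w.length : ℤ)) → ∀ k, st w k c = sharp)
    (hst1 : ∀ w (c : ℕ) (h : c < w.length), st w 0 (c + 1) = letter w[c])
    (hst2 : ∀ w k (c : ℕ), c + k + 1 < w.length →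
      st w (k + 1) (c + 1) = step (st w k c) (st w k (c + 1)) (st w k (c + 1 + 1))) :
    ({w | w ≠ [] ∧ st w (w.length - 1) 1 ∈ acc} : Language α) ∈ RealTimeCA α := by
  -- States of an automaton must live in `Type`, so they are renamed by `Fin m`.
  obtain ⟨m, ⟨e⟩⟩ := Finite.exists_equiv_fin Q
  let A : CellularAutomaton α {-1, 0, 1} :=
    { Q := Fin m
      finite_Q := inferInstance
      letter := letter.trans e.toEmbedding
      sharp := e sharp
      sharp_ne_letter := fun s h => hsharp s (e.injective h)
      accept := {q | e.symm q ∈ acc}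
      δ := fun u => e (step (e.symm (u (-1) (by simp))) (e.symm (u 0 (by simp)))
        (e.symm (u 1 (by simp)))) }
  -- Only the dependence cone of the output cell is compared; the right border never enters it.
  have key : ∀ w k (c : ℕ), c + k < w.length → A.stateAfter w k (c + 1) = e (st w k (c + 1)) := by
    intro w k
    induction k with
    | zero =>
      intro c hc
      rw [hst1 w c hc, stateAfter, dif_pos (by omega)]
      simp [A]
    | succ k ih =>
      intro c hc
      rw [hst2 w k c (by omega), stateAfter, if_pos (by omega)]
      have hl : A.stateAfter w k ((c : ℤ) + 1 + -1) = e (st w k c) := by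
        rcases c with _ | c
        · rw [hst0 w _ (by simp)]
          cases k <;> simp [stateAfter, A]
        · have := ih c (by omega)
          push_cast
          rwa [add_neg_cancel_right]
      have hm := ih c (by omega)
      have hr := ih (c + 1) (by omega)
      push_cast at hr
      simp only [A] at hl hm hr ⊢
      simp only [hl, add_zero, hm, hr, Equiv.symm_apply_apply]
  refine ⟨A, ?_⟩
  ext w
  change (w ≠ [] ∧ A.stateAfter w (w.length - 1) 1 ∈ A.accept) ↔ (w ≠ [] ∧ _)
  refine and_congr_right fun hw => ?_
  have hpos := List.length_pos_iff.2 hw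
  have := key w (w.length - 1) 0 (by omega)
  simp only [Nat.cast_zero, zero_add] at this
  rw [this]
  simp [A]

/-- One step of the automaton evaluating a triangular recurrence. -/
def triangleStep {T : Type*} (corner : Option α → T) (edge : T → Option α → T)
    (inner : T → T → T) (diag : T → T) :
    Option (α ⊕ T × T) → Option (α ⊕ T × T) → Option (α ⊕ T × T) → Option (α ⊕ T × T)
  | none, some (.inl a), some (.inl b) =>
    some (.inr (edge (corner (some a)) (some b), diag (edge (corner (some a)) (some b))))
  | none, some (.inr p), some (.inl b) =>
    some (.inr (inner (edge p.1 (some b)) p.2, diag (inner (edge p.1 (some b)) p.2)))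
  | none, some (.inr p), some (.inr q) =>
    some (.inr (inner q.2 p.2, diag (inner q.2 p.2)))
  | some (.inr l), some (.inl a), some (.inl b) =>
    some (.inr (edge (edge l.1 (some a)) (some b),
      inner (edge (edge l.1 (some a)) (some b)) (inner (edge l.1 (some a)) l.2)))
  | some (.inr l), some (.inr p), some (.inl b) =>
    some (.inr (inner (edge p.1 (some b)) p.2,
      inner (inner (edge p.1 (some b)) p.2) (inner p.2 l.2)))
  | some (.inr l), some (.inr p), some (.inr q) =>
    some (.inr (inner q.2 p.2, inner (inner q.2 p.2) (inner p.2 l.2)))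
  | _, _, q => q

/-- The space-time diagram of the automaton evaluating the triangular recurrence `G`: after `k`
steps, the cell of index `c` from the left holds the values at `(k - c - 1, k + c)` and
`(k - c, k + c)` if `c < k`, and the letter at `k + c` otherwise. -/
def triangleState {T : Type*} (G : List α → ℕ → ℕ → T) (w : List α) (k c : ℕ) :
    Option (α ⊕ T × T) :=
  if c < k then some (.inr (G w (k - c - 1) (k + c), G w (k - c) (k + c)))
  else w[k + c]?.map .inl

section Triangle

variable {T : Type*} {corner : Option α → T} {edge : T → Option α → T}
    {inner : T → T → T} {diag : T → T} {G : List α → ℕ → ℕ → T}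
    (hcorner : ∀ w, G w 0 0 = corner w[0]?)
    (hedge : ∀ w y, G w 0 (y + 1) = edge (G w 0 y) w[y + 1]?)
    (hinner : ∀ w x y, x < y → G w (x + 1) (y + 1) = inner (G w x (y + 1)) (G w (x + 1) y))
    (hdiag : ∀ w x, G w (x + 1) (x + 1) = diag (G w x (x + 1)))

include hcorner hedge hinner hdiag in
-- The leftmost cell lies on the diagonal of the triangle: no left neighbor supplies a value, and
-- `diag` takes the place of the second `inner`.
theorem triangleStep_left (w : List α) (k : ℕ) (hk : k + 1 < w.length) :
    triangleStep corner edge inner diag none (triangleState G w k 0) (triangleState G w k 1) =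
      triangleState G w (k + 1) 0 := by
  -- For k = 0 both cells still hold letters, for k = 1 only the right one does, and afterwards
  -- neither.
  rcases k with _ | _ | k
  · have h0 : w[0]? = some w[0] := List.getElem?_eq_getElem _
    have h1 : w[1]? = some w[1] := List.getElem?_eq_getElem _
    simp [triangleState, triangleStep, h0, h1, hcorner, hedge, hdiag]
  · have h2 : w[2]? = some w[2] := List.getElem?_eq_getElem _
    simp [triangleState, triangleStep, h2, hedge, hdiag w 1, hinner w 0 1]
  · simp [triangleState, triangleStep, hdiag w (k + 2), hinner w (k + 1) (k + 2)]

include hedge hinner in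
theorem triangleStep_right (w : List α) (k c : ℕ) (hk : c + 1 + k + 1 < w.length) :
    triangleStep corner edge inner diag (triangleState G w k c) (triangleState G w k (c + 1))
      (triangleState G w k (c + 2)) = triangleState G w (k + 1) (c + 1) := by
  -- If k ≤ c, the computation front has not arrived and letters just shift left. Otherwise d = k -
  -- 1 - c: for d = 0 the middle and right cells hold letters, for d = 1 only the right one, and
  -- beyond that none.
  rcases lt_or_ge c k with hck | hck
  · obtain ⟨d, rfl⟩ := Nat.exists_eq_add_of_lt hck
    have e1 : c + d + 1 + (c + 1) = (c + d + 1 + c) + 1 := by omega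
    have e2 : c + d + 1 + (c + 2) = (c + d + 1 + c) + 1 + 1 := by omega
    have e3 : c + d + 1 + 1 + (c + 1) = (c + d + 1 + c) + 1 + 1 := by omega
    have e4 : c + d + 1 - c = d + 1 := by omega
    have e5 : c + d + 1 - (c + 1) = d := by omega
    have e6 : c + d + 1 - (c + 2) = d - 1 := by omega
    have e7 : c + d + 1 + 1 - (c + 1) = d + 1 := by omega
    have hy : d < c + d + 1 + c := by omega
    have hw : c + d + 1 + c + 1 + 1 < w.length := by omega
    simp only [triangleState, e1, e2, e3, e4, e5, e6, e7, hck, if_true, Nat.add_sub_cancel,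
      show c + 1 < c + d + 1 + 1 by omega]
    generalize c + d + 1 + c = y at hy hw
    have h1 : w[y + 1]? = some w[y + 1] := List.getElem?_eq_getElem _
    have h2 : w[y + 1 + 1]? = some w[y + 1 + 1] := List.getElem?_eq_getElem _
    rw [hinner w d (y + 1) (by omega), hinner w d y hy]
    rcases d with _ | _ | d
    · simp [triangleStep, h1, h2, hedge]
    · simp [triangleStep, h2, hedge, hinner w 0 (y + 1)]
    · simp [triangleStep, hinner w (d + 1) (y + 1) (by omega)]
  · have h0 : w[k + c]? = some w[k + c] := List.getElem?_eq_getElem _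
    have h2 : w[k + (c + 2)]? = some w[k + (c + 2)] := List.getElem?_eq_getElem _
    simp [triangleState, triangleStep, hck.not_gt, h0, h2, show ¬ c + 2 < k by omega,
      show k + 1 + (c + 1) = k + (c + 2) by omega]

include hcorner hedge hinner hdiag in
/-- A property of the last value of a triangular recurrence over a finite set is decided in real
time by a cellular automaton. -/
theorem mem_realTimeCA_of_triangle [Finite α] [Finite T] (acc : Set T) :
    ({w | w ≠ [] ∧ G w (w.length - 1) (w.length - 1) ∈ acc} : Language α) ∈ RealTimeCA α := by
  -- A one-letter word is judged after zero steps, when its cell still holds the bare letter; hence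
  -- the first alternative.
  let accept : Set (Option (α ⊕ T × T)) :=
    {q | (∃ a, q = some (.inl a) ∧ corner (some a) ∈ acc) ∨ ∃ p, q = some (.inr p) ∧ p.2 ∈ acc}
  have := mem_realTimeCA_of_step (α := α)
    ⟨fun a => some (.inl a), fun a b h => by simpa using h⟩ none (by simp)
    (triangleStep corner edge inner diag) accept
    (fun w k c => if 1 ≤ c ∧ c ≤ (w.length : ℤ) then triangleState G w k (c - 1).toNat else none)
    (by intro w c h k; simp only [if_neg h])
    (by
      intro w c h
      have : (1 : ℤ) ≤ c + 1 ∧ (c : ℤ) + 1 ≤ w.length := by omega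
      simp [triangleState, h]
      rfl)
    (by
      intro w k c h
      have h1 : (1 : ℤ) ≤ c + 1 ∧ (c : ℤ) + 1 ≤ w.length := by omega
      have h2 : (1 : ℤ) ≤ c + 1 + 1 ∧ (c : ℤ) + 1 + 1 ≤ w.length := by omega
      have e1 : ((c : ℤ) + 1 - 1).toNat = c := by omega
      have e2 : ((c : ℤ) + 1 + 1 - 1).toNat = c + 1 := by omega
      simp only [if_pos h1, if_pos h2, e1, e2]
      rcases c with _ | c
      · simpa using (triangleStep_left hcorner hedge hinner hdiag w k (by omega)).symm
      · have h0 : (1 : ℤ) ≤ ((c + 1 : ℕ) : ℤ) ∧ ((c + 1 : ℕ) : ℤ) ≤ w.length := by omega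
        have e0 : (((c + 1 : ℕ) : ℤ) - 1).toNat = c := by omega
        rw [if_pos h0, e0]
        exact (triangleStep_right hedge hinner w k c (by omega)).symm)
  convert this using 1
  ext w
  refine and_congr_right fun hw => ?_
  rcases w with _ | ⟨a, _ | ⟨b, w⟩⟩
  · exact absurd rfl hw
  · simp [triangleState, accept, hcorner]
  · have h : (0 : ℤ) ≤ (w.length : ℤ) + 1 := by omega
    simp [triangleState, accept, h]

end Triangle

end CellularAutomaton

/-! ## Least models of Horn rules -/

namespace PredHorn

variable {α : Type*} {κ : Type}

/-- The value of a variable when `x = i` and `y = j`. -/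
def Var.natValue (i j : ℕ) : Var → ℕ
  | .x => i
  | .y => j

/-- The interpretation of `min` and `max` on `ℕ`, where `mx` interprets `max`. -/
def Extremum.Eval (mx : ℕ → Prop) : Extremum → ℕ → Prop
  | .min, p => p = 0
  | .max, p => mx p

/-- Truth of a hypothesis over `ℕ`, where the letters are read in `w` and `mx` interprets `max`. -/
def Hypothesis.Eval (w : List α) (mx : ℕ → Prop) (P : κ → ℕ → ℕ → Prop) (i j : ℕ) :
    Hypothesis α κ → Prop
  | .letter s v a => w[v.natValue i j - a]? = some s
  | .pos U v a => U.Eval mx (v.natValue i j - a)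
  | .neg U v a => ¬ U.Eval mx (v.natValue i j - a)
  | .compXY S a b => P S (i - a) (j - b)
  | .compYX S b a => P S (j - b) (i - a)

/-- The largest number of predecessors taken in a hypothesis. -/
def Hypothesis.offset : Hypothesis α κ → ℕ
  | .letter _ _ a => a
  | .pos _ _ a => a
  | .neg _ _ a => a
  | .compXY _ a b => a + b
  | .compYX _ b a => a + b

/-- The positions `p` of `w` and `p'` of `w'` look alike up to distance `D`. -/
def SimilarAt (D : ℕ) (w w' : List α) (p p' : ℕ) : Prop :=
  ∀ a ≤ D, w[p - a]? = w'[p' - a]? ∧ (p - a = 0 ↔ p' - a = 0)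

theorem SimilarAt.symm {D : ℕ} {w w' : List α} {p p' : ℕ} (h : SimilarAt D w w' p p') :
    SimilarAt D w' w p' p := fun a ha => ⟨(h a ha).1.symm, (h a ha).2.symm⟩

theorem SimilarAt.succ {D : ℕ} {w w' : List α} {p p' : ℕ} (h : SimilarAt D w w' p p')
    (hl : w[p + 1]? = w'[p' + 1]?) : SimilarAt D w w' (p + 1) (p' + 1) := by
  rintro (_ | a) ha
  · simpa using hl
  · simpa using h a (by omega)

theorem Hypothesis.Eval.transfer {D : ℕ} {w w' : List α} {mx mx' : ℕ → Prop}
    {P P' : κ → ℕ → ℕ → Prop} {i j i' j' : ℕ} {h : Hypothesis α κ} (hD : h.offset ≤ D)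
    (hi : SimilarAt D w w' i i') (hj : SimilarAt D w w' j j')
    (hmi : ∀ a ≤ D, mx (i - a) ↔ mx' (i' - a)) (hmj : ∀ a ≤ D, mx (j - a) ↔ mx' (j' - a))
    (hxy : ∀ S, ∀ a ≤ D, ∀ b ≤ D, P S (i - a) (j - b) → P' S (i' - a) (j' - b))
    (hyx : ∀ S, ∀ a ≤ D, ∀ b ≤ D, P S (j - b) (i - a) → P' S (j' - b) (i' - a))
    (H : h.Eval w mx P i j) : h.Eval w' mx' P' i' j' := by
  rcases h with ⟨s, v, a⟩ | ⟨U, v, a⟩ | ⟨U, v, a⟩ | ⟨S, a, b⟩ | ⟨S, b, a⟩ <;>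
    simp only [Hypothesis.offset] at hD
  · cases v
    · exact (hi a hD).1.symm.trans H
    · exact (hj a hD).1.symm.trans H
  · cases U <;> cases v
    · exact (hi a hD).2.1 H
    · exact (hj a hD).2.1 H
    · exact (hmi a hD).1 H
    · exact (hmj a hD).1 H
  · cases U <;> cases v
    · exact fun h => H ((hi a hD).2.2 h)
    · exact fun h => H ((hj a hD).2.2 h)
    · exact fun h => H ((hmi a hD).2 h)
    · exact fun h => H ((hmj a hD).2 h)
  · exact hxy S a (by omega) b (by omega) H
  · exact hyx S a (by omega) b (by omega) H

/-- A Horn rule whose conclusion is a computation atom. -/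
abbrev Rule (α : Type*) (κ : Type) := List (Hypothesis α κ) × κ

/-- The relations `P` satisfy all the rules. -/
def Closed (rules : Set (Rule α κ)) (w : List α) (mx : ℕ → Prop) (P : κ → ℕ → ℕ → Prop) : Prop :=
  ∀ r ∈ rules, ∀ i j, (∀ h ∈ r.1, h.Eval w mx P i j) → P r.2 i j

/-- The least model of the rules. -/
def Least (rules : Set (Rule α κ)) (w : List α) (mx : ℕ → Prop) (R : κ) (i j : ℕ) : Prop :=
  ∀ P, Closed rules w mx P → P R i j

section Rules

variable {rules : Set (Rule α κ)}

theorem Least.of_closed {w : List α} {mx : ℕ → Prop} {P : κ → ℕ → ℕ → Prop}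
    (hP : Closed rules w mx P) {R : κ} {i j : ℕ} (h : Least rules w mx R i j) : P R i j :=
  h P hP

theorem Hypothesis.Eval.mono {w : List α} {mx : ℕ → Prop} {P P' : κ → ℕ → ℕ → Prop} {i j : ℕ}
    {h : Hypothesis α κ} (hP : ∀ S i j, P S i j → P' S i j) (H : h.Eval w mx P i j) :
    h.Eval w mx P' i j :=
  H.transfer le_rfl (fun _ _ => ⟨rfl, Iff.rfl⟩) (fun _ _ => ⟨rfl, Iff.rfl⟩)
    (fun _ _ => Iff.rfl) (fun _ _ => Iff.rfl) (fun _ _ _ _ _ => hP _ _ _)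
    (fun _ _ _ _ _ => hP _ _ _)

theorem closed_least (rules : Set (Rule α κ)) (w : List α) (mx : ℕ → Prop) :
    Closed rules w mx (Least rules w mx) := fun r hr i j H P hP =>
  hP r hr i j fun h hh => (H h hh).mono fun _ _ _ hS => hS P hP

/-- The least model on `[0, N)²` depends only on the interpretation of `max` on `[0, N)`. -/
theorem Least.congr_max {w : List α} {mx mx' : ℕ → Prop} {N : ℕ}
    (hmx : ∀ p < N, mx p ↔ mx' p) {R : κ} {i j : ℕ} (hi : i < N) (hj : j < N)
    (H : Least rules w mx R i j) : Least rules w mx' R i j := by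
  -- Truncated predecessors never leave [0, N), so relations unconstrained outside this square are
  -- still closed under the rules.
  refine H.of_closed (P := fun R i j => i < N → j < N → Least rules w mx' R i j) ?_ hi hj
  intro r hr i j H hi hj
  refine closed_least rules w mx' r hr i j fun h hh => ?_
  exact (H h hh).transfer le_rfl (fun _ _ => ⟨rfl, Iff.rfl⟩) (fun _ _ => ⟨rfl, Iff.rfl⟩)
    (fun _ _ => hmx _ (by omega)) (fun _ _ => hmx _ (by omega))
    (fun _ _ _ _ _ h => h (by omega) (by omega)) (fun _ _ _ _ _ h => h (by omega) (by omega))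

/-- Transfer between two pairs of positions whose neighborhoods look alike. The neighbors that are
marked `new` coincide with the positions themselves. -/
theorem Least.transfer {D : ℕ} (hD : ∀ r ∈ rules, ∀ h ∈ r.1, h.offset ≤ D) {w w' : List α}
    {mx mx' : ℕ → Prop} {x y x' y' : ℕ} (new : ℕ → ℕ → Prop)
    (hnew : ∀ a b, new a b → (x - a = x ∧ y - b = y) ∧ x' - a = x' ∧ y' - b = y')
    (hx : SimilarAt D w w' x x') (hy : SimilarAt D w w' y y')
    (hmx : ∀ a ≤ D, mx (x - a) ↔ mx' (x' - a)) (hmy : ∀ a ≤ D, mx (y - a) ↔ mx' (y' - a))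
    (hold : ∀ S, ∀ a ≤ D, ∀ b ≤ D, ¬ new a b →
      (Least rules w mx S (x - a) (y - b) → Least rules w' mx' S (x' - a) (y' - b)) ∧
      (Least rules w mx S (y - b) (x - a) → Least rules w' mx' S (y' - b) (x' - a)))
    (S : κ) :
    ∀ a ≤ D, ∀ b ≤ D,
      (Least rules w mx S (x - a) (y - b) → Least rules w' mx' S (x' - a) (y' - b)) ∧
      (Least rules w mx S (y - b) (x - a) → Least rules w' mx' S (y' - b) (x' - a)) := by
  -- Rules may use atoms at the very pair being concluded, or at its mirror image, so known
  -- neighbors alone do not suffice. Putting the conclusion for both orientations into `P` and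
  -- showing `P` closed replays on the primed side every derivation step made at these two pairs.
  let P : κ → ℕ → ℕ → Prop := fun R i j => Least rules w mx R i j ∧
    (i = x → j = y → Least rules w' mx' R x' y') ∧ (i = y → j = x → Least rules w' mx' R y' x')
  have hPxy : ∀ S, ∀ a ≤ D, ∀ b ≤ D, P S (x - a) (y - b) →
      Least rules w' mx' S (x' - a) (y' - b) := by
    intro S a ha b hb H
    by_cases hab : new a b
    · obtain ⟨⟨e1, e2⟩, e3, e4⟩ := hnew a b hab
      rw [e3, e4]
      exact H.2.1 e1 e2
    · exact (hold S a ha b hb hab).1 H.1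
  have hPyx : ∀ S, ∀ a ≤ D, ∀ b ≤ D, P S (y - b) (x - a) →
      Least rules w' mx' S (y' - b) (x' - a) := by
    intro S a ha b hb H
    by_cases hab : new a b
    · obtain ⟨⟨e1, e2⟩, e3, e4⟩ := hnew a b hab
      rw [e3, e4]
      exact H.2.2 e2 e1
    · exact (hold S a ha b hb hab).2 H.1
  have hP : Closed rules w mx P := by
    intro r hr i j H
    refine ⟨closed_least rules w mx r hr i j fun h hh => (H h hh).mono fun _ _ _ h => h.1, ?_, ?_⟩
    · rintro rfl rfl
      exact closed_least rules w' mx' r hr x' y' fun h hh =>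
        (H h hh).transfer (hD r hr h hh) hx hy hmx hmy hPxy hPyx
    · rintro rfl rfl
      exact closed_least rules w' mx' r hr y' x' fun h hh =>
        (H h hh).transfer (hD r hr h hh) hy hx hmy hmx
          (fun S a ha b hb => hPyx S b hb a ha) (fun S a ha b hb => hPxy S b hb a ha)
  exact fun a ha b hb => ⟨fun H => hPxy S a ha b hb (H.of_closed hP),
    fun H => hPyx S a ha b hb (H.of_closed hP)⟩

/-- The interpretation of `max` that holds at `y` only if `μ` is `true`, and nowhere otherwise. -/
def maxAt (μ : Bool) (y p : ℕ) : Prop := μ = true ∧ p = y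

/-- The values of a signature. -/
abbrev Signature (α : Type*) (κ : Type) (D : ℕ) :=
  (Fin (D + 1) → (Option α × Prop) × (Option α × Prop)) ×
    (Bool → κ → Fin (D + 1) → Fin (D + 1) → Prop × Prop)

/-- The description of the window of size `D` below `(x, y)`: the letters, the occurrences of the
first position, and the atoms that hold in the least model for `max` holding nowhere, or at `y`. -/
def signature (rules : Set (Rule α κ)) (D : ℕ) (w : List α) (x y : ℕ) : Signature α κ D :=
  (fun a => ((w[x - a]?, x - a = 0), (w[y - a]?, y - a = 0)),
    fun μ S a b => (Least rules w (maxAt μ y) S (x - a) (y - b),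
      Least rules w (maxAt μ y) S (y - b) (x - a)))

theorem signature_eq_iff {D : ℕ} {w w' : List α} {x y x' y' : ℕ} :
    signature rules D w x y = signature rules D w' x' y' ↔
      SimilarAt D w w' x x' ∧ SimilarAt D w w' y y' ∧
      ∀ μ S, ∀ a ≤ D, ∀ b ≤ D,
        (Least rules w (maxAt μ y) S (x - a) (y - b) ↔
          Least rules w' (maxAt μ y') S (x' - a) (y' - b)) ∧
        (Least rules w (maxAt μ y) S (y - b) (x - a) ↔
          Least rules w' (maxAt μ y') S (y' - b) (x' - a)) := by
  simp only [signature, Prod.mk.injEq, funext_iff, Fin.forall_iff, Nat.lt_succ_iff, eq_iff_iff,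
    forall_and, SimilarAt]
  tauto

theorem signature_eq_of {D : ℕ} (hD : ∀ r ∈ rules, ∀ h ∈ r.1, h.offset ≤ D) {w w' : List α}
    {x y x' y' : ℕ} (new : ℕ → ℕ → Prop)
    (hnew : ∀ a b, new a b → (x - a = x ∧ y - b = y) ∧ x' - a = x' ∧ y' - b = y')
    (hx : SimilarAt D w w' x x') (hy : SimilarAt D w w' y y')
    (hmx : ∀ a ≤ D, x - a = y ↔ x' - a = y')
    (hold : ∀ μ S, ∀ a ≤ D, ∀ b ≤ D, ¬ new a b →
      (Least rules w (maxAt μ y) S (x - a) (y - b) ↔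
        Least rules w' (maxAt μ y') S (x' - a) (y' - b)) ∧
      (Least rules w (maxAt μ y) S (y - b) (x - a) ↔
        Least rules w' (maxAt μ y') S (y' - b) (x' - a))) :
    signature rules D w x y = signature rules D w' x' y' := by
  -- With truncated subtraction, y - b = y means b = 0 or y = 0, and similarity makes y and y'
  -- vanish together.
  have h0 := (hy 0 (Nat.zero_le _)).2
  have hmy : ∀ b, y - b = y ↔ y' - b = y' := fun b => by omega
  refine signature_eq_iff.2 ⟨hx, hy, fun μ S a ha b hb => ?_⟩
  have h1 := Least.transfer hD (mx := maxAt μ y) (mx' := maxAt μ y') new hnew hx hy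
    (fun a ha => and_congr_right fun _ => hmx a ha) (fun b _ => and_congr_right fun _ => hmy b)
    (fun S a ha b hb hab => ⟨(hold μ S a ha b hb hab).1.1, (hold μ S a ha b hb hab).2.1⟩) S a ha b hb
  have h2 := Least.transfer hD (mx := maxAt μ y') (mx' := maxAt μ y) new
    (fun a b hab => (hnew a b hab).symm) hx.symm hy.symm
    (fun a ha => and_congr_right fun _ => (hmx a ha).symm)
    (fun b _ => and_congr_right fun _ => (hmy b).symm)
    (fun S a ha b hb hab => ⟨(hold μ S a ha b hb hab).1.2, (hold μ S a ha b hb hab).2.2⟩) S a ha b hb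
  exact ⟨⟨h1.1, h2.1⟩, ⟨h1.2, h2.2⟩⟩

/-- On [0, y] a maximum placed at y + 1 is invisible, so old atoms come from the version with `max`
nowhere, whichever version is wanted next. -/
theorem least_maxAt_succ {w : List α} {μ : Bool} {y i j : ℕ} {S : κ} (hi : i ≤ y) (hj : j ≤ y) :
    Least rules w (maxAt μ (y + 1)) S i j ↔ Least rules w (maxAt false y) S i j := by
  have h : ∀ p < y + 1, maxAt μ (y + 1) p ↔ maxAt false y p := fun p hp => by
    simp [maxAt, hp.ne]
  exact ⟨Least.congr_max h (by omega) (by omega),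
    Least.congr_max (fun p hp => (h p hp).symm) (by omega) (by omega)⟩

/-! ### The recurrence satisfied by signatures -/

section Determined

variable {D : ℕ} (hD : ∀ r ∈ rules, ∀ h ∈ r.1, h.offset ≤ D) {w w' : List α} {x y x' y' : ℕ}

include hD

theorem signature_corner (h : w[0]? = w'[0]?) :
    signature rules D w 0 0 = signature rules D w' 0 0 :=
  signature_eq_of hD (fun _ _ => True) (by simp) (by simp [SimilarAt, h]) (by simp [SimilarAt, h])
    (by simp) (by simp)

theorem signature_edge (h : signature rules D w 0 y = signature rules D w' 0 y')
    (hl : w[y + 1]? = w'[y' + 1]?) :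
    signature rules D w 0 (y + 1) = signature rules D w' 0 (y' + 1) := by
  obtain ⟨hx, hy, hS⟩ := signature_eq_iff.1 h
  -- As 0 - a = 0, every window entry with b = 0 is the new pair itself, whatever a is.
  refine signature_eq_of hD (fun _ b => b = 0) (by simp) hx (hy.succ hl) (by simp) ?_
  rintro μ S a ha (_ | b) hb hab
  · simp at hab
  · rw [Nat.add_sub_add_right, Nat.add_sub_add_right]
    have := hS false S a ha b (by omega)
    iterate 4 rw [least_maxAt_succ (by omega) (by omega)]
    exact this

theorem signature_inner (hxy : x < y) (hxy' : x' < y')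
    (h1 : signature rules D w x (y + 1) = signature rules D w' x' (y' + 1))
    (h2 : signature rules D w (x + 1) y = signature rules D w' (x' + 1) y') :
    signature rules D w (x + 1) (y + 1) = signature rules D w' (x' + 1) (y' + 1) := by
  obtain ⟨-, hy, hS1⟩ := signature_eq_iff.1 h1
  obtain ⟨hx, -, hS2⟩ := signature_eq_iff.1 h2
  refine signature_eq_of hD (fun a b => a = 0 ∧ b = 0) (by simp) hx hy (fun a _ => by omega) ?_
  rintro μ S (_ | a) ha b hb hab
  · rcases b with _ | b
    · simp at hab
    · rw [Nat.add_sub_add_right, Nat.add_sub_add_right]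
      have := hS2 false S 0 ha b (by omega)
      iterate 4 rw [least_maxAt_succ (by omega) (by omega)]
      exact this
  · rw [Nat.add_sub_add_right, Nat.add_sub_add_right]
    exact hS1 μ S a (by omega) b hb

theorem signature_diag
    (h : signature rules D w x (x + 1) = signature rules D w' x' (x' + 1)) :
    signature rules D w (x + 1) (x + 1) = signature rules D w' (x' + 1) (x' + 1) := by
  obtain ⟨-, hy, hS⟩ := signature_eq_iff.1 h
  refine signature_eq_of hD (fun a b => a = 0 ∧ b = 0) (by simp) hy hy (fun a _ => by omega) ?_
  rintro μ S (_ | a) ha b hb hab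
  · rcases b with _ | b
    · simp at hab
    · rw [Nat.add_sub_add_right, Nat.add_sub_add_right]
      -- The atom at (x + 1, x - b) is the mirrored component of the signature at (x, x + 1); `symm`
      -- exchanges the two orientations.
      exact (hS μ S b (by omega) 0 ha).symm
  · rw [Nat.add_sub_add_right, Nat.add_sub_add_right]
    exact hS μ S a (by omega) b hb

end Determined

theorem exists_offset_bound (hr : rules.Finite) :
    ∃ D, ∀ r ∈ rules, ∀ h ∈ r.1, h.offset ≤ D := by
  have hf : (⋃ r ∈ rules, {h | h ∈ r.1}).Finite := hr.biUnion fun r _ => r.1.finite_toSet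
  obtain ⟨D, hD⟩ := (hf.image Hypothesis.offset).bddAbove
  exact ⟨D, fun r hr h hh => hD ⟨h, by simp only [Set.mem_iUnion]; exact ⟨r, hr, hh⟩, rfl⟩⟩

/-- A function that factors through another one on the level of equalities factors through a map. -/
theorem exists_factor {ι A B : Type*} [Nonempty B] (p : ι → A) (q : ι → B)
    (h : ∀ i i', p i = p i' → q i = q i') : ∃ f : A → B, ∀ i, q i = f (p i) :=
  ⟨Function.extend p q fun _ => Classical.arbitrary B, fun i =>
    ((Function.FactorsThrough.extend_apply (fun i i' => h i i') _ i)).symm⟩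

/-- Finitely many Horn rules are evaluated in real time by a cellular automaton. -/
theorem least_mem_realTimeCA [Finite α] [Finite κ] (hr : rules.Finite) (S : κ) :
    ({w | w ≠ [] ∧ ¬ Least rules w (· = w.length - 1) S (w.length - 1) (w.length - 1)} :
      Language α) ∈ RealTimeCA α := by
  obtain ⟨D, hD⟩ := exists_offset_bound hr
  have : Nonempty (Signature α κ D) := ⟨signature rules D [] 0 0⟩
  obtain ⟨corner, hcorner⟩ := exists_factor (fun w : List α => w[0]?)
    (fun w => signature rules D w 0 0) fun w w' h => signature_corner hD h
  obtain ⟨edge, hedge⟩ := exists_factor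
    (fun i : List α × ℕ => (signature rules D i.1 0 i.2, i.1[i.2 + 1]?))
    (fun i => signature rules D i.1 0 (i.2 + 1)) fun i i' h =>
      signature_edge hD (Prod.ext_iff.1 h).1 (Prod.ext_iff.1 h).2
  obtain ⟨inner, hinner⟩ := exists_factor
    (fun i : {i : List α × ℕ × ℕ // i.2.1 < i.2.2} =>
      (signature rules D i.1.1 i.1.2.1 (i.1.2.2 + 1), signature rules D i.1.1 (i.1.2.1 + 1) i.1.2.2))
    (fun i => signature rules D i.1.1 (i.1.2.1 + 1) (i.1.2.2 + 1)) fun i i' h =>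
      signature_inner hD i.2 i'.2 (Prod.ext_iff.1 h).1 (Prod.ext_iff.1 h).2
  obtain ⟨diag, hdiag⟩ := exists_factor
    (fun i : List α × ℕ => signature rules D i.1 i.2 (i.2 + 1))
    (fun i => signature rules D i.1 (i.2 + 1) (i.2 + 1)) fun i i' h => signature_diag hD h
  have := CellularAutomaton.mem_realTimeCA_of_triangle (G := signature rules D) hcorner
    (edge := fun s l => edge (s, l)) (fun w y => hedge (w, y))
    (inner := fun s t => inner (s, t)) (fun w x y hxy => hinner ⟨(w, x, y), hxy⟩)
    (fun w x => hdiag (w, x)) {s | ¬ (s.2 true S 0 0).1}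
  -- At the final corner y is the last position, so the version with `max` at y is the true
  -- interpretation.
  have hmax : ∀ y, maxAt true y = (· = y) := fun y => by simp [maxAt, funext_iff]
  simpa [signature, hmax] using this

end Rules

/-! ## From formulas to automata -/

/-- Renaming of the computation predicates. -/
def Hypothesis.map {ρ : Type} (f : ρ → κ) : Hypothesis α ρ → Hypothesis α κ
  | .letter s v a => .letter s v a
  | .pos U v a => .pos U v a
  | .neg U v a => .neg U v a
  | .compXY S a b => .compXY (f S) a b
  | .compYX S b a => .compYX (f S) b a

/-- The rules of a formula, where `none` stands for falsity, and falsity spreads upwards. -/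
def Formula.rules (Φ : Formula α) : Set (Rule α (Option Φ.ρ)) :=
  (fun C : Clause α Φ.ρ => (C.hyps.map (Hypothesis.map some), C.concl)) '' {C | C ∈ Φ.clauses} ∪
    {([.compXY none 1 0], none), ([.compXY none 0 1], none)}

theorem Formula.finite_rules (Φ : Formula α) : Φ.rules.Finite :=
  (Φ.clauses.finite_toSet.image _).union (by simp)

theorem val_iterate_pred {n : ℕ} (a : ℕ) (i : Fin n) : (pred^[a] i).val = i.val - a := by
  induction a with
  | zero => rfl
  | succ a ih => rw [Function.iterate_succ_apply']; simp only [pred, ih]; omega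

theorem Hypothesis.eval_map_iff {ρ : Type} {w : List α} {P : Option ρ → ℕ → ℕ → Prop}
    {R : ρ → Fin w.length → Fin w.length → Prop} (hP : ∀ S (i j : Fin w.length), P (some S) i j ↔ R S i j)
    (i j : Fin w.length) (h : Hypothesis α ρ) :
    (h.map some).Eval w (· = w.length - 1) P i j ↔ h.Holds w R i j := by
  have hv : ∀ (v : Var) (a : ℕ), v.natValue i j - a = (pred^[a] (v.value i j)).val := by
    intro v a
    rw [val_iterate_pred]
    cases v <;> rfl
  have hU : ∀ (U : Extremum) (p : Fin w.length), U.Eval (· = w.length - 1) p ↔ U.Holds p := by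
    intro U p
    have := p.2
    cases U <;> simp only [Extremum.Eval, Extremum.Holds] <;> omega
  rcases h with ⟨s, v, a⟩ | ⟨U, v, a⟩ | ⟨U, v, a⟩ | ⟨S, a, b⟩ | ⟨S, b, a⟩ <;>
    simp only [Hypothesis.map, Hypothesis.Eval, Hypothesis.Holds, hv, hU, ← val_iterate_pred, hP]
  all_goals simp

/-- The least model is contained in every model, and it satisfies the clauses concluding falsity
unless falsity is derived somewhere; the spreading rules then bring it to the last corner. -/
theorem Formula.sat_iff (Φ : Formula α) {w : List α} (hw : w ≠ []) :
    Φ.Sat w ↔ ¬ Least Φ.rules w (· = w.length - 1) none (w.length - 1) (w.length - 1) := by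
  have hpos := List.length_pos_iff.2 hw
  constructor
  · rintro ⟨R, hR⟩ H
    -- Inside the word falsity is interpreted as false; outside, everything holds, which keeps `P`
    -- closed there for free.
    let P : Option Φ.ρ → ℕ → ℕ → Prop := fun S i j => ∀ (hi : i < w.length) (hj : j < w.length),
      S.elim False fun S => R S ⟨i, hi⟩ ⟨j, hj⟩
    refine H.of_closed (P := P) ?_ (by omega) (by omega)
    rintro r (⟨C, hC, rfl⟩ | rfl | rfl) i j H hi hj
    · have := hR ⟨i, hi⟩ ⟨j, hj⟩ C hC fun h hh => (Hypothesis.eval_map_iff (P := P)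
        (fun S i j => ⟨fun H => H i.2 j.2, fun H _ _ => H⟩) ⟨i, hi⟩ ⟨j, hj⟩ h).1
        (H _ (List.mem_map_of_mem hh))
      dsimp only
      rcases h : C.concl with _ | S
      · simp [h] at this
      · simpa [h] using this
    · exact H _ (List.mem_singleton_self _) (by omega) (by omega)
    · exact H _ (List.mem_singleton_self _) (by omega) (by omega)
  · intro H
    have hcl := closed_least Φ.rules w (· = w.length - 1)
    refine ⟨fun S i j => Least Φ.rules w (· = w.length - 1) (some S) i j, fun i j C hC hh => ?_⟩
    have h := hcl _ (Or.inl ⟨C, hC, rfl⟩) i j (by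
      intro h' hh'
      obtain ⟨h, hm, rfl⟩ := List.mem_map.1 hh'
      exact (Hypothesis.eval_map_iff (fun _ _ _ => Iff.rfl) i j h).2 (hh h hm))
    dsimp only at h
    rcases hc : C.concl with _ | S
    · refine H ?_
      rw [hc] at h
      -- Falsity derived at (i, j) is carried to the last corner, first along x and then along y.
      have hx : ∀ d, Least Φ.rules w (· = w.length - 1) none (i + d) j := by
        intro d
        induction d with
        | zero => exact h
        | succ d ih =>
          refine hcl _ (Or.inr (Or.inl rfl)) _ _ ?_
          simpa [Hypothesis.Eval] using ih
      have hy : ∀ d, Least Φ.rules w (· = w.length - 1) none (w.length - 1) (j + d) := by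
        intro d
        induction d with
        | zero =>
          have := hx (w.length - 1 - i)
          rwa [Nat.add_sub_cancel' (by omega)] at this
        | succ d ih =>
          refine hcl _ (Or.inr (Or.inr rfl)) _ _ ?_
          simpa [Hypothesis.Eval] using ih
      have := hy (w.length - 1 - j)
      rwa [Nat.add_sub_cancel' (by omega)] at this
    · rw [hc] at h
      exact h

theorem predESOHorn_subset_realTimeCA [Finite α] : PredESOHorn α ⊆ RealTimeCA α := by
  rintro _ ⟨Φ, rfl⟩
  have := Φ.finite_ρ
  have h : Φ.language = {w | w ≠ [] ∧
      ¬ Least Φ.rules w (· = w.length - 1) none (w.length - 1) (w.length - 1)} :=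
    Set.ext fun w => and_congr_right fun hw => Φ.sat_iff hw
  exact h ▸ least_mem_realTimeCA Φ.finite_rules none

end PredHorn

/-! ## From automata to formulas -/

namespace CellularAutomaton

open PredHorn

variable {α : Type*} (A : CellularAutomaton α {-1, 0, 1})

/-- The transition function applied to the states of the left, middle and right cells. -/
def next (l m r : A.Q) : A.Q :=
  A.δ fun v _ => if v = -1 then l else if v = 0 then m else r

theorem stateAfter_succ (w : List α) (k : ℕ) (c : ℤ) (hc : 1 ≤ c ∧ c ≤ (w.length : ℤ)) :
    A.stateAfter w (k + 1) c =
      A.next (A.stateAfter w k (c - 1)) (A.stateAfter w k c) (A.stateAfter w k (c + 1)) := by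
  rw [stateAfter, if_pos hc, next]
  congr 1
  funext v hv
  simp only [Finset.mem_insert, Finset.mem_singleton] at hv
  rcases hv with rfl | rfl | rfl <;> simp [sub_eq_add_neg]

theorem stateAfter_zero_left (w : List α) (k : ℕ) : A.stateAfter w k 0 = A.sharp := by
  cases k <;> simp [stateAfter]

/-- The predicates of the formula of an automaton: `x = y`, `x < y`, and the states; the state of
the site of cell `y - x + 1` at time `x` is described at `(x, y)`, for `x ≤ y`. -/
inductive Predicate (Q : Type)
  | eq
  | lt
  | state (q : Q)

instance {Q : Type} [Finite Q] : Finite (Predicate Q) :=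
  Finite.of_injective (β := Option (Option Q))
    (fun | .eq => none | .lt => some none | .state q => some (some q))
    (by rintro (_ | _ | q) (_ | _ | q') h <;> simp_all)

/-- The clauses of the formula of an automaton. -/
inductive IsClause : Clause α (Predicate A.Q) → Prop
  | eq_zero : IsClause ⟨[.pos .min .x 0, .pos .min .y 0], some .eq⟩
  | eq_succ : IsClause ⟨[.neg .min .x 0, .neg .min .y 0, .compXY .eq 1 1], some .eq⟩
  | lt_of_eq : IsClause ⟨[.neg .min .y 0, .compXY .eq 0 1], some .lt⟩
  | lt_of_lt : IsClause ⟨[.neg .min .y 0, .compXY .lt 0 1], some .lt⟩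
  | input (s : α) : IsClause ⟨[.pos .min .x 0, .letter s .y 0], some (.state (A.letter s))⟩
  | left (m r : A.Q) : IsClause ⟨[.neg .min .x 0, .compXY .eq 0 0, .compXY (.state m) 1 1,
      .compXY (.state r) 1 0], some (.state (A.next A.sharp m r))⟩
  | step (l m r : A.Q) : IsClause ⟨[.neg .min .x 0, .compXY .lt 0 0, .compXY (.state l) 1 2,
      .compXY (.state m) 1 1, .compXY (.state r) 1 0], some (.state (A.next l m r))⟩
  | reject (q : A.Q) (hq : q ∉ A.accept) : IsClause ⟨[.pos .max .x 0, .pos .max .y 0,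
      .compXY (.state q) 0 0], none⟩

theorem finite_isClause [Finite α] : {C | A.IsClause C}.Finite := by
  have := A.finite_Q
  refine Set.Finite.subset (s := {⟨[.pos .min .x 0, .pos .min .y 0], some .eq⟩,
    ⟨[.neg .min .x 0, .neg .min .y 0, .compXY .eq 1 1], some .eq⟩,
    ⟨[.neg .min .y 0, .compXY .eq 0 1], some .lt⟩,
    ⟨[.neg .min .y 0, .compXY .lt 0 1], some .lt⟩} ∪
    Set.range (fun s => ⟨[.pos .min .x 0, .letter s .y 0], some (.state (A.letter s))⟩) ∪
    Set.range (fun p : A.Q × A.Q => ⟨[.neg .min .x 0, .compXY .eq 0 0, .compXY (.state p.1) 1 1,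
      .compXY (.state p.2) 1 0], some (.state (A.next A.sharp p.1 p.2))⟩) ∪
    Set.range (fun p : A.Q × A.Q × A.Q => ⟨[.neg .min .x 0, .compXY .lt 0 0,
      .compXY (.state p.1) 1 2, .compXY (.state p.2.1) 1 1, .compXY (.state p.2.2) 1 0],
      some (.state (A.next p.1 p.2.1 p.2.2))⟩) ∪
    Set.range (fun q => ⟨[.pos .max .x 0, .pos .max .y 0, .compXY (.state q) 0 0], none⟩)) ?_ ?_
  · refine ((((Set.toFinite _).union ?_).union ?_).union ?_).union ?_ <;> exact Set.finite_range _
  · rintro C (_ | _ | _ | _ | s | ⟨m, r⟩ | ⟨l, m, r⟩ | ⟨q, hq⟩)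
    · simp
    · simp
    · simp
    · simp
    · exact Or.inl <| Or.inl <| Or.inl <| Or.inr ⟨s, rfl⟩
    · exact Or.inl <| Or.inl <| Or.inr ⟨(m, r), rfl⟩
    · exact Or.inl <| Or.inr ⟨(l, m, r), rfl⟩
    · exact Or.inr ⟨q, rfl⟩

/-- The predecessor Horn formula of an automaton. -/
noncomputable def formula [Finite α] : Formula α where
  ρ := Predicate A.Q
  finite_ρ := have := A.finite_Q; inferInstance
  clauses := A.finite_isClause.toFinset.toList

theorem mem_clauses_formula [Finite α] {C : Clause α (Predicate A.Q)} :
    C ∈ A.formula.clauses ↔ A.IsClause C :=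
  Finset.mem_toList.trans (Set.Finite.mem_toFinset _)

/-- The state described at `(i, j)`, for positions counted from `0`. -/
def site (w : List α) (i j : ℕ) : A.Q := A.stateAfter w i ((j : ℤ) - i + 1)

theorem site_zero {w : List α} {j : ℕ} (hj : j < w.length) : A.site w 0 j = A.letter w[j] := by
  rw [site, stateAfter, dif_pos (by omega)]
  simp

theorem site_diag {w : List α} {i : ℕ} (hi : i + 1 < w.length) :
    A.site w (i + 1) (i + 1) = A.next A.sharp (A.site w i i) (A.site w i (i + 1)) := by
  rw [site, stateAfter_succ _ _ _ _ (by omega), site, site]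
  congr 1
  · rw [← A.stateAfter_zero_left w i]
    congr 1
    omega
  all_goals congr 1; push_cast; ring

theorem site_step {w : List α} {i j : ℕ} (hij : i ≤ j) (hj : j + 2 < w.length) :
    A.site w (i + 1) (j + 2) =
      A.next (A.site w i j) (A.site w i (j + 1)) (A.site w i (j + 2)) := by
  rw [site, stateAfter_succ _ _ _ _ (by omega), site, site, site]
  congr 2 <;> push_cast <;> ring

theorem site_last (w : List α) :
    A.site w (w.length - 1) (w.length - 1) = A.stateAfter w (w.length - 1) 1 := by
  simp [site]

/-- The intended interpretation of the predicates. -/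
def interp (w : List α) : Predicate A.Q → Fin w.length → Fin w.length → Prop
  | .eq, i, j => i.val = j.val
  | .lt, i, j => i.val < j.val
  | .state q, i, j => i.val ≤ j.val ∧ A.site w i j = q

theorem sat_formula_of_accept [Finite α] {w : List α}
    (h : A.stateAfter w (w.length - 1) 1 ∈ A.accept) : A.formula.Sat w := by
  refine ⟨A.interp w, ?_⟩
  rintro ⟨i, hi⟩ ⟨j, hj⟩ C hC
  change Clause.Holds (ρ := Predicate A.Q) C w (A.interp w) ⟨i, hi⟩ ⟨j, hj⟩
  rcases A.mem_clauses_formula.1 hC with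
    _ | _ | _ | _ | s | ⟨m, r⟩ | ⟨l, m, r⟩ | ⟨q, hq⟩ <;>
    simp only [Clause.Holds, List.forall_mem_cons, List.not_mem_nil, false_imp_iff, implies_true,
      and_true] <;>
    simp only [Hypothesis.Holds, Extremum.Holds, Var.value, Function.iterate_zero, id,
      Function.iterate_succ, Function.comp, interp, pred, and_imp]
  · omega
  · omega
  · omega
  · omega
  · intro h0 hs
    obtain rfl : i = 0 := by omega
    exact ⟨by omega, by rw [A.site_zero hj, ← hs]; rfl⟩
  · rintro h0 rfl - hm - hr
    obtain ⟨i, rfl⟩ : ∃ k, i = k + 1 := ⟨i - 1, by omega⟩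
    exact ⟨le_rfl, by rw [A.site_diag hi, ← hm, ← hr]; rfl⟩
  · rintro h0 hlt - hl - hm - hr
    obtain ⟨i, rfl⟩ : ∃ k, i = k + 1 := ⟨i - 1, by omega⟩
    -- The `lt` hypothesis gives j > i ≥ 1, so j - 2 is a genuine predecessor; at i = j = 1
    -- truncation would have read a wrong cell.
    obtain ⟨j, rfl⟩ : ∃ k, j = k + 2 := ⟨j - 2, by omega⟩
    exact ⟨by omega, by rw [A.site_step (by omega) hj, ← hl, ← hm, ← hr]; rfl⟩
  · rintro h1 h2 - rfl
    obtain rfl : i = w.length - 1 := by omega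
    obtain rfl : j = w.length - 1 := by omega
    exact hq (by rwa [A.site_last w])

/-- Minimality in the other direction: `eq` and `lt` are forced wherever they are true, and then the
true states are forced row by row, so a rejecting run triggers the clause concluding falsity in
every candidate model. -/
theorem state_of_closed {w : List α}
    {R : Predicate A.Q → Fin w.length → Fin w.length → Prop}
    (hR : ∀ i j, ∀ C, A.IsClause C → C.Holds w R i j) (i : ℕ) :
    ∀ (j : ℕ) (hi : i < w.length) (hj : j < w.length), i ≤ j →
      R (.state (A.site w i j)) ⟨i, hi⟩ ⟨j, hj⟩ := by
  have hclause : ∀ C, A.IsClause C → ∀ (i j : ℕ) (hi : i < w.length) (hj : j < w.length),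
      C.Holds w R ⟨i, hi⟩ ⟨j, hj⟩ := fun C hC i j hi hj => hR _ _ C hC
  have heq : ∀ (i : ℕ) (hi : i < w.length), R .eq ⟨i, hi⟩ ⟨i, hi⟩ := by
    intro i
    induction i with
    | zero => exact fun hi => hclause _ .eq_zero 0 0 hi hi (by
        simp [Hypothesis.Holds, Extremum.Holds, Var.value])
    | succ i ih => exact fun hi => hclause _ .eq_succ (i + 1) (i + 1) hi hi (by
        simpa [Hypothesis.Holds, Extremum.Holds, Var.value, pred] using ih (by omega))
  have hlt : ∀ (d i : ℕ) (hj : i + d + 1 < w.length), R .lt ⟨i, by omega⟩ ⟨i + d + 1, hj⟩ := by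
    intro d
    induction d with
    | zero => exact fun i hj => hclause _ .lt_of_eq i (i + 1) (by omega) hj (by
        simpa [Hypothesis.Holds, Extremum.Holds, Var.value, pred] using heq i (by omega))
    | succ d ih => exact fun i hj => hclause _ .lt_of_lt i (i + d + 1 + 1) (by omega) hj (by
        simpa [Hypothesis.Holds, Extremum.Holds, Var.value, pred] using ih i (by omega))
  induction i with
  | zero =>
    intro j hi hj _
    rw [A.site_zero hj]
    exact hclause _ (.input w[j]) 0 j hi hj (by
      simp [Hypothesis.Holds, Extremum.Holds, Var.value])
  | succ i ih =>
    intro j hi hj hij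
    rcases hij.eq_or_lt with rfl | hij
    · rw [A.site_diag hi]
      exact hclause _ (.left _ _) (i + 1) (i + 1) hi hi (by
        simpa [Hypothesis.Holds, Extremum.Holds, Var.value, pred] using
          ⟨heq (i + 1) hi, ih i (by omega) (by omega) le_rfl, ih (i + 1) (by omega) hi (by omega)⟩)
    · obtain ⟨d, rfl⟩ := Nat.exists_eq_add_of_lt hij
      have h := hlt d (i + 1) hj
      obtain ⟨j, hj'⟩ : ∃ k, i + 1 + d + 1 = k + 2 := ⟨i + d, by omega⟩
      simp only [hj'] at h hj ⊢
      rw [A.site_step (by omega) hj]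
      exact hclause _ (.step _ _ _) (i + 1) (j + 2) hi hj (by
        simpa [Hypothesis.Holds, Extremum.Holds, Var.value, pred] using
          ⟨h, ih j (by omega) (by omega) (by omega), ih (j + 1) (by omega) (by omega) (by omega),
            ih (j + 2) (by omega) hj (by omega)⟩)

theorem accept_of_sat_formula [Finite α] {w : List α} (hw : w ≠ []) (h : A.formula.Sat w) :
    A.stateAfter w (w.length - 1) 1 ∈ A.accept := by
  obtain ⟨R, hR⟩ := h
  have hpos := List.length_pos_iff.2 hw
  have hR' : ∀ i j, ∀ C, A.IsClause C → C.Holds w R i j :=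
    fun i j C hC => hR i j C (A.mem_clauses_formula.2 hC)
  have := A.state_of_closed hR' (w.length - 1) (w.length - 1) (by omega) (by omega) le_rfl
  rw [A.site_last w] at this
  by_contra hq
  refine hR' ⟨w.length - 1, by omega⟩ ⟨w.length - 1, by omega⟩ _ (.reject _ hq) ?_
  simpa [Hypothesis.Holds, Extremum.Holds, Var.value, Nat.sub_add_cancel hpos] using this

theorem realTimeCA_subset_predESOHorn [Finite α] : RealTimeCA α ⊆ PredESOHorn α := by
  rintro _ ⟨A, rfl⟩
  refine ⟨A.formula, ?_⟩
  ext w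
  exact and_congr_right fun hw => ⟨A.accept_of_sat_formula hw, A.sat_formula_of_accept⟩

end CellularAutomaton

theorem mainTheorem1 (α : Type*) [Finite α] : RealTimeCA α = PredESOHorn α :=
  Set.Subset.antisymm CellularAutomaton.realTimeCA_subset_predESOHorn
    PredHorn.predESOHorn_subset_realTimeCA
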